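/- Let $N\ge 1$ and let $\mathcal G$ be a directed graph without loops on the nodes $\mathcal I=\{1,\dots,N\}$; write $\mathcal V(i)\subset\mathcal I\setminus\{i\}$ for the set of $j$ such that there is an edge from $i$ to $j$, and assume that $\mathcal G$ is connected in the sense that every node can be reached from every other one along directed edges. For each $i$ let $L(i,\cdot):\mathbb R_+^{\mathcal V(i)}\to\mathbb R\cup\{+\infty\}$ be a cost function such that: (A1) for every $i$ there is a vector $\lambda$ with all coordinates $\lambda_j>0$ ($j\in\mathcal V(i)$) and $L(i,\lambda)<+\infty$; (A2) every $L(i,\cdot)$ is lower semi-continuous; (A3) there is $\underline C\in\mathbb R$ with $L(i,\lambda)\ge\underline C$ for all $i$ and $\lambda$; (A4) for every $i$, $L(i,\lambda)/\|\lambda\|_\infty\to+\infty$ as $\|\lambda\|_\infty\to+\infty$. Define the Hamiltonians $H(i,p)=\sup_{\lambda\in\mathbb R_+^{\mathcal V(i)}}\big(\sum_{j\in\mathcal V(i)}\lambda_jp_j-L(i,\lambda)\big)$ for $p\in\mathbb R^{\mathcal V(i)}$. An admissible control is a family of deterministic non-negative functions $t\mapsto\lambda_t(i,j)$, $t\ge0$,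 $i\in\mathcal I$, $j\in\mathcal V(i)$, that are integrable on $[0,T]$ for every $T>0$. On a filtered probability space, let $X^{i,\lambda}$ denote, for every node $i$ and every admissible control $\lambda$, the continuous-time Markov chain started from $i$ at time $0$ whose transition rate from $k$ to $j\in\mathcal V(k)$ at time $t$ is $\lambda_t(k,j)$ (an adapted càdlàg process solving the corresponding martingale problem). For $r>0$ let $$u_i^r=\sup_{\lambda}\ \mathbb E\left[-\int_0^{+\infty}e^{-rt}L\Big(X_t^{i,\lambda},\big(\lambda_t(X_t^{i,\lambda},j)\big)_{j\in\mathcal V(X_t^{i,\lambda})}\Big)\,dt\right],$$ the supremum being taken over all admissible controls. Then every $u_i^r$ ($i\in\mathcal I$, $r>0$) is finite and: 1. there is $\gamma\in\mathbb R$ such that $\lim_{r\to0^+}r\,u_i^r=\gamma$ for all $i\in\mathcal I$; 2. there is a sequence $(r_n)_{n\in\mathbb N}$ of positive numbers converging to $0$ such that $(u_i^{r_n}-u_1^{r_n})_{n\in\mathbb N}$ converges for all $i\in\mathcal I$; 3. for every sequence $(r_n)$ of positive numbers converging to $0$ such that the limits $\xi_i=\lim_{n\to\infty}(u_i^{r_n}-u_1^{r_n})\in\mathbb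 R$ exist for all $i\in\mathcal I$, one has $$-\gamma+H\big(i,(\xi_j-\xi_i)_{j\in\mathcal V(i)}\big)=0\qquad\text{for all } i\in\mathcal I.$$ -/

import Mathlib

open Filter Topology MeasureTheory
open scoped NNReal ENNReal

namespace GraphControl

noncomputable section

/-- The Lebesgue integral of an extended-real-valued function, `∫ f⁺ dμ - ∫ f⁻ dμ`. It is the
usual integral in `[-∞, +∞]` as soon as one of the two parts has finite integral; here it is only
applied to functions that are bounded from below (or from above) by an integrable function. -/
def extendedIntegral {α : Type*} [MeasurableSpace α] (μ : Measure α) (f : α → EReal) : EReal :=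
  ((∫⁻ x, (f x).toENNReal ∂μ : ℝ≥0∞) : EReal) - ((∫⁻ x, (-f x).toENNReal ∂μ : ℝ≥0∞) : EReal)

/-- A directed graph on `{0, …, N - 1}` is given by the out-neighbourhoods `V i`. It has no loops
and any node can be reached from any other one along directed edges. -/
structure IsConnectedDigraph {N : ℕ} (V : Fin N → Finset (Fin N)) : Prop where
  loopless : ∀ i, i ∉ V i
  connected : ∀ i j, Relation.ReflTransGen (fun k l => l ∈ V k) i j

/-- The supremum norm `‖(l_j)_j‖_∞` of a non-negative vector. -/
def supNorm {ι : Type*} [Fintype ι] (l : ι → ℝ≥0) : ℝ := ‖fun j => (l j : ℝ)‖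

/-- The Hamiltonian `H(i, p) = sup_l (∑_{j ∈ V(i)} l_j p_j - L(i, l))`, the supremum being taken
over all non-negative vectors `l` indexed by `V(i)`. -/
def hamiltonian {N : ℕ} {V : Fin N → Finset (Fin N)} (L : (i : Fin N) → (V i → ℝ≥0) → EReal)
    (i : Fin N) (p : V i → ℝ) : EReal :=
  ⨆ l : V i → ℝ≥0, (((∑ j, (l j : ℝ) * p j : ℝ) : EReal) - L i l)

/-- A deterministic feedback control `(λ_t(i, j))` with `t ≥ 0`, `i` a node and `j ∈ V(i)`. -/
abbrev Control {N : ℕ} (V : Fin N → Finset (Fin N)) : Type :=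
  ℝ≥0 → (i : Fin N) → V i → ℝ≥0

/-- A control is admissible if `t ↦ λ_t(i, j)` is integrable on `[0, T]` for all `T`, `i`, `j`. -/
def IsAdmissible {N : ℕ} {V : Fin N → Finset (Fin N)} (a : Control V) : Prop :=
  ∀ (T : ℝ) (i : Fin N) (j : V i),
    IntegrableOn (fun t : ℝ => (a t.toNNReal i j : ℝ)) (Set.Icc 0 T) volume

/-- The generator at time `t` of the chain controlled by `a`:
`f ↦ ∑_{j ∈ V(k)} λ_t(k, j) (f j - f k)`. -/
def generator {N : ℕ} {V : Fin N → Finset (Fin N)} (a : Control V) (t : ℝ≥0)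
    (f : Fin N → ℝ) (k : Fin N) : ℝ :=
  ∑ j : V k, (a t k j : ℝ) * (f j - f k)

/-- `X` is a continuous-time Markov chain started from `i` at time `0` whose transition rate from
`k` to `j ∈ V(k)` at time `t` is `λ_t(k, j)`: an adapted process with càdlàg paths that solves the
martingale problem for the (time-dependent) generator. -/
structure IsControlledChain {Ω : Type*} {m : MeasurableSpace Ω} (P : Measure Ω)
    (ℱ : Filtration ℝ≥0 m) {N : ℕ} {V : Fin N → Finset (Fin N)} (a : Control V) (i : Fin N)
    (X : ℝ≥0 → Ω → Fin N) : Prop where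
  adapted : ∀ t, Measurable[ℱ t] (X t)
  right_continuous : ∀ ω t, ∀ᶠ s in 𝓝[>] t, X s ω = X t ω
  left_limits : ∀ ω t, ∃ k, ∀ᶠ s in 𝓝[<] t, X s ω = k
  start : ∀ᵐ ω ∂P, X 0 ω = i
  martingale : ∀ f : Fin N → ℝ,
    Martingale (fun (t : ℝ≥0) ω => f (X t ω) - f (X 0 ω)
      - ∫ s in (0 : ℝ)..t, generator a s.toNNReal f (X s.toNNReal ω)) ℱ P

/-- The discounted cost `∫_0^∞ e^{-rt} L(X_t, (λ_t(X_t, j))_{j ∈ V(X_t)}) dt` of a path `x`. -/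
def pathCost {N : ℕ} {V : Fin N → Finset (Fin N)} (L : (i : Fin N) → (V i → ℝ≥0) → EReal)
    (r : ℝ) (a : Control V) (x : ℝ≥0 → Fin N) : EReal :=
  extendedIntegral (volume.restrict (Set.Ici (0 : ℝ))) fun t =>
    ((Real.exp (-(r * t)) : ℝ) : EReal) * L (x t.toNNReal) (a t.toNNReal (x t.toNNReal))

/-- The value function of the infinite-horizon problem with discount rate `r`:
`u_i^r = sup_λ E[-∫_0^∞ e^{-rt} L(X_t, (λ_t(X_t, j))_j) dt]` over the admissible controls `λ`,
where `X = X^{i,λ}` is the chain started from `i` and controlled by `λ`. -/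
def value {Ω : Type*} {m : MeasurableSpace Ω} (P : Measure Ω) {N : ℕ}
    {V : Fin N → Finset (Fin N)} (L : (i : Fin N) → (V i → ℝ≥0) → EReal)
    (X : Fin N → Control V → ℝ≥0 → Ω → Fin N) (r : ℝ) (i : Fin N) : EReal :=
  ⨆ (a : Control V) (_ : IsAdmissible a),
    extendedIntegral P fun ω => -pathCost L r a (fun t => X i a t ω)

end

end GraphControl

/-! The values are identified with the solution of the stationary equation `r v_i = H(i, (v_j -
v_i)_j)`, and the limit `r → 0` is then taken in that equation alone. Each `H(i, ·)` is a finite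
supremum of affine functions with non-negative slopes, hence nondecreasing, convex and continuous.
Perron's method solves the equation (`exists_isDiscountedSolution`). By Dynkin's formula a solution
bounds the payoff of every control from above, and constant-in-time feedbacks that are almost
optimal in `H` come arbitrarily close to it (`value_eq_of_isDiscountedSolution`).

Evaluating the equation at an extremum of `v` bounds `r v` uniformly in `r`. A finite-cost vector
with positive rates makes `H` grow in every coordinate, so a bound on `v` above its minimum travels
along edges, and connectedness bounds all differences (`exists_abs_sub_le_of_isDiscountedSolution`).
Compactness gives subsequential limits `(γ, ξ)`, which solve `H(i, (ξ_j - ξ_i)_j) = γ` by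
continuity. Comparison (`ergodic_constant_le`) makes `γ` unique, so the whole family `r u^r`
converges. -/

namespace GraphControl

/-- The real-valued version of the Hamiltonian. -/
noncomputable def realHamiltonian {N : ℕ} {V : Fin N → Finset (Fin N)}
    (L : (i : Fin N) → (V i → ℝ≥0) → EReal) (i : Fin N) (p : V i → ℝ) : ℝ :=
  (hamiltonian L i p).toReal

/-! ### Finiteness, monotonicity, convexity and continuity of the Hamiltonian -/

section Hamiltonian

variable {N : ℕ} {V : Fin N → Finset (Fin N)} {L : (i : Fin N) → (V i → ℝ≥0) → EReal}

lemma coe_le_supNorm {ι : Type*} [Fintype ι] (l : ι → ℝ≥0) (j : ι) : (l j : ℝ) ≤ supNorm l :=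
  (Real.le_norm_self _).trans (norm_le_pi_norm (fun j => (l j : ℝ)) j)

lemma sum_mul_le_supNorm_mul {ι : Type*} [Fintype ι] (l : ι → ℝ≥0) (p : ι → ℝ) :
    ∑ j, (l j : ℝ) * p j ≤ supNorm l * ∑ j, |p j| := by
  rw [Finset.mul_sum]
  refine Finset.sum_le_sum fun j _ => ?_
  calc (l j : ℝ) * p j ≤ l j * |p j| := by gcongr; exact le_abs_self _
    _ ≤ supNorm l * |p j| := by gcongr; exact coe_le_supNorm l j

lemma exists_mul_supNorm_le {i : Fin N}
    (hL : Tendsto (fun l => L i l / (supNorm l : EReal)) (comap supNorm atTop) (𝓝 ⊤)) (K : ℝ) :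
    ∃ R : ℝ, ∀ l, R ≤ supNorm l → ∀ c : ℝ, L i l = c → K * supNorm l ≤ c := by
  have h := (EReal.tendsto_nhds_top_iff_real.1 hL K)
  obtain ⟨R, hR⟩ := Filter.eventually_atTop.1 (Filter.eventually_comap.1 h)
  -- The threshold 1 keeps the norm positive, so that the quotient can be cleared.
  refine ⟨max R 1, fun l hl c hc => ?_⟩
  have hs : 0 < supNorm l := lt_of_lt_of_le one_pos ((le_max_right _ _).trans hl)
  have h2 := hR (supNorm l) ((le_max_left _ _).trans hl) l rfl
  rw [hc, ← EReal.coe_div, EReal.coe_lt_coe_iff, lt_div_iff₀ hs] at h2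
  exact h2.le

lemma hamiltonian_ne_bot {i : Fin N} {l : V i → ℝ≥0} (hl : L i l < ⊤) (p : V i → ℝ) :
    hamiltonian L i p ≠ ⊥ := by
  refine ne_of_gt (lt_of_lt_of_le ?_ (le_iSup _ l))
  induction h : L i l using EReal.rec with
  | bot => exact bot_lt_top
  | coe c => exact EReal.bot_lt_coe _
  | top => exact absurd h hl.ne

/-- The linear term is at most `‖l‖ ∑ |p_j|`. Beyond some radius `R` superlinear growth lets the
cost absorb it; within that radius it is bounded and the cost is at least `C`. -/
lemma hamiltonian_ne_top {i : Fin N} {C : ℝ} (hC : ∀ l, (C : EReal) ≤ L i l)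
    (hL : Tendsto (fun l => L i l / (supNorm l : EReal)) (comap supNorm atTop) (𝓝 ⊤))
    (p : V i → ℝ) : hamiltonian L i p ≠ ⊤ := by
  obtain ⟨R, hR⟩ := exists_mul_supNorm_le hL (∑ j, |p j|)
  have hp : 0 ≤ ∑ j, |p j| := Finset.sum_nonneg fun _ _ => abs_nonneg _
  refine ne_of_lt (lt_of_le_of_lt (b := ((|R| * ∑ j, |p j| + |C| : ℝ) : EReal)) ?_
    (EReal.coe_lt_top _))
  refine iSup_le fun l => ?_
  induction h : L i l using EReal.rec with
  | bot => exact absurd (h ▸ hC l) (not_le.2 (EReal.bot_lt_coe _))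
  | coe c =>
    rw [← EReal.coe_sub, EReal.coe_le_coe_iff]
    have h1 := sum_mul_le_supNorm_mul l p
    have h2 : C ≤ c := EReal.coe_le_coe_iff.1 ((hC l).trans_eq h)
    have h3 : -|C| ≤ C := neg_abs_le C
    rcases le_total R (supNorm l) with h4 | h4
    · have h5 := hR l h4 c h
      have : 0 ≤ |R| * ∑ j, |p j| := by positivity
      linarith [mul_comm (supNorm l) (∑ j, |p j|), abs_nonneg C]
    · have : supNorm l * ∑ j, |p j| ≤ |R| * ∑ j, |p j| := by
        gcongr; exact h4.trans (le_abs_self R)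
      linarith
  | top => simp

lemma coe_realHamiltonian {i : Fin N} (h0 : ∃ l, L i l < ⊤) {C : ℝ}
    (hC : ∀ l, (C : EReal) ≤ L i l)
    (hL : Tendsto (fun l => L i l / (supNorm l : EReal)) (comap supNorm atTop) (𝓝 ⊤))
    (p : V i → ℝ) : (realHamiltonian L i p : EReal) = hamiltonian L i p :=
  EReal.coe_toReal (hamiltonian_ne_top hC hL p) (hamiltonian_ne_bot h0.choose_spec p)

/-- Vectors of infinite cost contribute `⊥` to the supremum, so only finite costs need testing. -/
lemma realHamiltonian_le_iff {i : Fin N} (h0 : ∃ l, L i l < ⊤) {C : ℝ}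
    (hC : ∀ l, (C : EReal) ≤ L i l)
    (hL : Tendsto (fun l => L i l / (supNorm l : EReal)) (comap supNorm atTop) (𝓝 ⊤))
    {p : V i → ℝ} {x : ℝ} :
    realHamiltonian L i p ≤ x ↔ ∀ l, ∀ c : ℝ, L i l = c → ∑ j, (l j : ℝ) * p j - c ≤ x := by
  rw [← EReal.coe_le_coe_iff, coe_realHamiltonian h0 hC hL, hamiltonian, iSup_le_iff]
  refine forall_congr' fun l => ⟨fun h c hc => ?_, fun h => ?_⟩
  · rwa [hc, ← EReal.coe_sub, EReal.coe_le_coe_iff] at h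
  · induction hl : L i l using EReal.rec with
    | bot => exact absurd (hl ▸ hC l) (not_le.2 (EReal.bot_lt_coe _))
    | coe c => exact EReal.coe_le_coe_iff.2 (h c hl)
    | top => simp

lemma sum_sub_le_realHamiltonian {i : Fin N} (h0 : ∃ l, L i l < ⊤) {C : ℝ}
    (hC : ∀ l, (C : EReal) ≤ L i l)
    (hL : Tendsto (fun l => L i l / (supNorm l : EReal)) (comap supNorm atTop) (𝓝 ⊤))
    (p : V i → ℝ) {l : V i → ℝ≥0} {c : ℝ} (hc : L i l = c) :
    ∑ j, (l j : ℝ) * p j - c ≤ realHamiltonian L i p :=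
  (realHamiltonian_le_iff h0 hC hL).1 le_rfl l c hc

lemma realHamiltonian_monotone {i : Fin N} (h0 : ∃ l, L i l < ⊤) {C : ℝ}
    (hC : ∀ l, (C : EReal) ≤ L i l)
    (hL : Tendsto (fun l => L i l / (supNorm l : EReal)) (comap supNorm atTop) (𝓝 ⊤)) :
    Monotone (realHamiltonian L i) := by
  intro p q hpq
  rw [realHamiltonian_le_iff h0 hC hL]
  intro l c hc
  refine le_trans ?_ (sum_sub_le_realHamiltonian h0 hC hL q hc)
  gcongr with j
  exact hpq j

lemma realHamiltonian_convexOn {i : Fin N} (h0 : ∃ l, L i l < ⊤) {C : ℝ}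
    (hC : ∀ l, (C : EReal) ≤ L i l)
    (hL : Tendsto (fun l => L i l / (supNorm l : EReal)) (comap supNorm atTop) (𝓝 ⊤)) :
    ConvexOn ℝ Set.univ (realHamiltonian L i) := by
  refine ⟨convex_univ, fun p _ q _ a b ha hb hab => ?_⟩
  rw [realHamiltonian_le_iff h0 hC hL]
  intro l c hc
  have h1 := mul_le_mul_of_nonneg_left (sum_sub_le_realHamiltonian h0 hC hL p hc) ha
  have h2 := mul_le_mul_of_nonneg_left (sum_sub_le_realHamiltonian h0 hC hL q hc) hb
  have h3 : ∑ j, (l j : ℝ) * (a • p + b • q) j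
      = a * ∑ j, (l j : ℝ) * p j + b * ∑ j, (l j : ℝ) * q j := by
    rw [Finset.mul_sum, Finset.mul_sum, ← Finset.sum_add_distrib]
    refine Finset.sum_congr rfl fun j _ => ?_
    simp only [Pi.add_apply, Pi.smul_apply, smul_eq_mul]
    ring
  have h4 : c = a * c + b * c := by rw [← add_mul, hab, one_mul]
  rw [h3, smul_eq_mul, smul_eq_mul]
  linarith

lemma realHamiltonian_continuous {i : Fin N} (h0 : ∃ l, L i l < ⊤) {C : ℝ}
    (hC : ∀ l, (C : EReal) ≤ L i l)
    (hL : Tendsto (fun l => L i l / (supNorm l : EReal)) (comap supNorm atTop) (𝓝 ⊤)) :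
    Continuous (realHamiltonian L i) :=
  (realHamiltonian_convexOn h0 hC hL).locallyLipschitz.continuous

end Hamiltonian

/-! ### The discounted equation and its vanishing discount limit -/

section StationaryEquation

variable {N : ℕ} {V : Fin N → Finset (Fin N)}

/-- `v` solves the stationary Hamilton-Jacobi equation `r v_i = H(i, (v_j - v_i)_j)`. -/
def IsDiscountedSolution (H : (i : Fin N) → (V i → ℝ) → ℝ) (r : ℝ) (v : Fin N → ℝ) : Prop :=
  ∀ i, r * v i = H i fun j => v j - v i

variable {H : (i : Fin N) → (V i → ℝ) → ℝ}

lemma abs_hamiltonian_zero_le (i : Fin N) : |H i 0| ≤ ∑ k, |H k 0| :=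
  Finset.single_le_sum (f := fun k => |H k 0|) (fun _ _ => abs_nonneg _) (Finset.mem_univ i)

/-- At a maximum point all differences are nonpositive, so monotonicity compares `H` with its value
at 0. -/
lemma mul_le_of_subsolution [NeZero N] (hmono : ∀ i, Monotone (H i)) {r : ℝ} (hr : 0 < r)
    {w : Fin N → ℝ} (hw : ∀ i, r * w i ≤ H i fun j => w j - w i) (i : Fin N) :
    r * w i ≤ ∑ k, |H k 0| := by
  obtain ⟨m, hm⟩ := Finite.exists_max w
  calc r * w i ≤ r * w m := by gcongr; exact hm i
    _ ≤ H m fun j => w j - w m := hw m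
    _ ≤ H m 0 := hmono m fun j => sub_nonpos.2 (hm j)
    _ ≤ _ := (le_abs_self _).trans (abs_hamiltonian_zero_le m)

lemma IsDiscountedSolution.abs_mul_le [NeZero N] (hmono : ∀ i, Monotone (H i)) {r : ℝ}
    (hr : 0 < r) {v : Fin N → ℝ} (hv : IsDiscountedSolution H r v) (i : Fin N) :
    |r * v i| ≤ ∑ k, |H k 0| := by
  refine abs_le.2 ⟨?_, mul_le_of_subsolution hmono hr (fun i => (hv i).le) i⟩
  obtain ⟨m, hm⟩ := Finite.exists_min v
  calc -∑ k, |H k 0| ≤ H m 0 :=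
        (neg_le_neg (abs_hamiltonian_zero_le m)).trans (neg_abs_le _)
    _ ≤ H m fun j => v j - v m := hmono m fun j => sub_nonneg.2 (hm j)
    _ = r * v m := (hv m).symm
    _ ≤ r * v i := by gcongr; exact hm i

/-- Perron's method. -/
lemma exists_isDiscountedSolution [NeZero N] (hmono : ∀ i, Monotone (H i))
    (hcont : ∀ i, Continuous (H i)) {r : ℝ} (hr : 0 < r) :
    ∃ v, IsDiscountedSolution H r v := by
  set S : Set (Fin N → ℝ) := {w | ∀ i, r * w i ≤ H i fun j => w j - w i} with hS
  set M := ∑ k, |H k 0| with hM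
  have hbdd : ∀ i, BddAbove ((fun w : Fin N → ℝ => w i) '' S) := fun i => by
    refine ⟨M / r, ?_⟩
    rintro _ ⟨w, hw, rfl⟩
    rw [le_div_iff₀ hr, mul_comm]
    exact mul_le_of_subsolution hmono hr hw i
  have hne : S.Nonempty := ⟨fun _ => -M / r, fun i => by
    have : (fun j : V i => -M / r - -M / r) = 0 := by ext; simp
    rw [this, mul_div_cancel₀ _ hr.ne']
    exact (neg_le_neg (abs_hamiltonian_zero_le i)).trans (neg_abs_le _)⟩
  set v : Fin N → ℝ := fun i => sSup ((fun w : Fin N → ℝ => w i) '' S) with hv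
  have hle : ∀ w ∈ S, ∀ i, w i ≤ v i := fun w hw i => le_csSup (hbdd i) ⟨w, hw, rfl⟩
  have hc : ∀ i, Continuous fun ε : ℝ => H i fun j => v j - v i + ε := fun i =>
    (hcont i).comp (by fun_prop)
  have hsub : v ∈ S := fun i => by
    -- Some subsolution `w` comes within `ε` of the supremum at `i` and stays below `v` elsewhere;
    -- letting `ε → 0` makes `v` itself a subsolution.
    have key : ∀ ε : ℝ, 0 < ε → r * (v i - ε) ≤ H i fun j => v j - v i + ε := fun ε hε => by
      obtain ⟨_, ⟨w, hw, rfl⟩, hlt⟩ := exists_lt_of_lt_csSup (hne.image fun w : Fin N → ℝ => w i)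
        (sub_lt_self (v i) hε)
      calc r * (v i - ε) ≤ r * w i := by gcongr
        _ ≤ H i fun j => w j - w i := hw i
        _ ≤ _ := hmono i fun j => by
          have := hle w hw j
          change w j - w i ≤ v j - v i + ε
          change v i - ε < w i at hlt
          linarith
    have h1 : Tendsto (fun ε : ℝ => r * (v i - ε)) (𝓝[>] 0) (𝓝 (r * (v i - 0))) :=
      (Continuous.tendsto (by fun_prop) 0).mono_left nhdsWithin_le_nhds
    have h2 := ((hc i).tendsto 0).mono_left (nhdsWithin_le_nhds (s := Set.Ioi 0))
    have := le_of_tendsto_of_tendsto h1 h2 (eventually_mem_nhdsWithin.mono fun ε hε => key ε hε)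
    simpa using this
  refine ⟨v, fun i => le_antisymm (hsub i) (not_lt.1 fun hlt => ?_)⟩
  -- A strict inequality at `i` survives a small increase of `v i`, which only raises the
  -- differences seen from other nodes. The raised vector is a subsolution, contradicting maximality
  -- of `v`.
  have h1 : ∀ᶠ ε : ℝ in 𝓝[>] 0, r * (v i + ε) < H i fun j => v j - v i + -ε := by
    refine nhdsWithin_le_nhds ((Continuous.tendsto (by fun_prop) 0).eventually_lt
      (((hc i).comp continuous_neg).tendsto 0) ?_)
    simpa using hlt
  obtain ⟨ε, h2, hε⟩ := (h1.and eventually_mem_nhdsWithin).exists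
  replace hε : 0 < ε := hε
  have hmem : Function.update v i (v i + ε) ∈ S := fun k => by
    have hge : ∀ j, v j ≤ Function.update v i (v i + ε) j := fun j => by
      rcases eq_or_ne j i with rfl | hj
      · simp [hε.le]
      · simp [hj]
    rcases eq_or_ne k i with rfl | hk
    · rw [Function.update_self]
      refine h2.le.trans (hmono k fun j => ?_)
      have := hge j
      dsimp only
      linarith
    · rw [Function.update_of_ne hk]
      exact (hsub k).trans (hmono k fun j => sub_le_sub_right (hge j) _)
  have := hle _ hmem i
  rw [Function.update_self] at this
  linarith

/-- Induction along the path. The equation at `k` bounds a positively weighted sum of the `v j - v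
k`. Measured from the minimum `v i`, all terms are nonnegative, so the one for the next node `m` can
be isolated. -/
lemma IsDiscountedSolution.exists_sub_le_of_reflTransGen [NeZero N]
    (hmono : ∀ i, Monotone (H i))
    (hcoer : ∀ i, ∃ (l : V i → ℝ) (c : ℝ), (∀ j, 0 < l j) ∧ ∀ p, ∑ j, l j * p j - c ≤ H i p)
    {i j : Fin N} (hij : Relation.ReflTransGen (fun k l => l ∈ V k) i j) :
    ∃ B : ℝ, ∀ r : ℝ, 0 < r → ∀ v, IsDiscountedSolution H r v → (∀ k, v i ≤ v k) →
      v j - v i ≤ B := by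
  induction hij with
  | refl => exact ⟨0, fun r _ v _ _ => by simp⟩
  | @tail k m _ hkm ih =>
    obtain ⟨B, hB⟩ := ih
    obtain ⟨l, c, hl, hH⟩ := hcoer k
    have hΛ : 0 ≤ ∑ j, l j := Finset.sum_nonneg fun j _ => (hl j).le
    refine ⟨(∑ k, |H k 0| + c + (∑ j, l j) * B) / l ⟨m, hkm⟩, fun r hr v hv hmin => ?_⟩
    rw [le_div_iff₀ (hl _)]
    have h1 := hH fun j => v j - v k
    have h2 := (le_abs_self _).trans (hv.abs_mul_le hmono hr k)
    rw [hv k] at h2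
    have h3 : ∑ j, l j * (v j - v k) = ∑ j, l j * (v j - v i) - (∑ j, l j) * (v k - v i) := by
      rw [Finset.sum_mul, ← Finset.sum_sub_distrib]
      exact Finset.sum_congr rfl fun j _ => by ring
    have h4 : l ⟨m, hkm⟩ * (v m - v i) ≤ ∑ j, l j * (v j - v i) :=
      Finset.single_le_sum (f := fun j : V k => l j * (v j - v i))
        (fun j _ => mul_nonneg (hl j).le (sub_nonneg.2 (hmin j))) (Finset.mem_univ (⟨m, hkm⟩ : V k))
    have h5 := mul_le_mul_of_nonneg_left (hB r hr v hv hmin) hΛ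
    linarith

lemma exists_abs_sub_le_of_isDiscountedSolution [NeZero N] (hV : IsConnectedDigraph V)
    (hmono : ∀ i, Monotone (H i))
    (hcoer : ∀ i, ∃ (l : V i → ℝ) (c : ℝ), (∀ j, 0 < l j) ∧ ∀ p, ∑ j, l j * p j - c ≤ H i p) :
    ∃ B : ℝ, ∀ r : ℝ, 0 < r → ∀ v, IsDiscountedSolution H r v → ∀ i j, |v i - v j| ≤ B := by
  choose B hB using fun i j =>
    IsDiscountedSolution.exists_sub_le_of_reflTransGen hmono hcoer (hV.connected i j)
  -- The minimizer depends on `v`, so the bound must cover every starting node.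
  refine ⟨∑ i, ∑ j, |B i j|, fun r hr v hv i j => ?_⟩
  obtain ⟨m, hm⟩ := Finite.exists_min v
  have key : ∀ k, v k - v m ≤ ∑ i, ∑ j, |B i j| := fun k =>
    ((hB m k r hr v hv hm).trans (le_abs_self _)).trans <|
      (Finset.single_le_sum (f := fun j => |B m j|) (fun _ _ => abs_nonneg _)
        (Finset.mem_univ k)).trans
      (Finset.single_le_sum (f := fun i => ∑ j, |B i j|)
        (fun _ _ => Finset.sum_nonneg fun _ _ => abs_nonneg _) (Finset.mem_univ m))
  rw [abs_le]
  constructor <;> linarith [key i, key j, hm i, hm j]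

/-- Comparison principle for the ergodic equation. -/
lemma ergodic_constant_le [NeZero N] (hmono : ∀ i, Monotone (H i)) {γ γ' : ℝ}
    {ξ ξ' : Fin N → ℝ} (h : ∀ i, H i (fun j => ξ j - ξ i) = γ)
    (h' : ∀ i, H i (fun j => ξ' j - ξ' i) = γ') : γ ≤ γ' := by
  obtain ⟨m, hm⟩ := Finite.exists_max fun i => ξ i - ξ' i
  rw [← h m, ← h' m]
  -- At a maximum of `ξ - ξ'` the differences of `ξ` are at most those of `ξ'`.
  exact hmono m fun j => by
    have := hm j
    dsimp only at this ⊢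
    linarith

lemma hamiltonian_eq_of_tendsto [NeZero N] (hcont : ∀ i, Continuous (H i)) {v : ℕ → Fin N → ℝ}
    {ρ : ℕ → ℝ} (hv : ∀ n, IsDiscountedSolution H (ρ n) (v n)) {γ : ℝ} {ξ : Fin N → ℝ} {i : Fin N}
    (hγ : Tendsto (fun n => ρ n * v n i) atTop (𝓝 γ))
    (hξ : ∀ i, Tendsto (fun n => v n i - v n 0) atTop (𝓝 (ξ i))) :
    H i (fun j => ξ j - ξ i) = γ := by
  have h1 : Tendsto (fun n => (fun j : V i => v n j - v n i)) atTop
      (𝓝 fun j : V i => ξ j - ξ i) := by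
    refine tendsto_pi_nhds.2 fun j => ?_
    simpa using (hξ j).sub (hξ i)
  have h2 := ((hcont i).tendsto _).comp h1
  refine tendsto_nhds_unique h2 (hγ.congr fun n => ?_)
  exact hv n i

lemma exists_subseq_tendsto [NeZero N] (hV : IsConnectedDigraph V)
    (hmono : ∀ i, Monotone (H i))
    (hcoer : ∀ i, ∃ (l : V i → ℝ) (c : ℝ), (∀ j, 0 < l j) ∧ ∀ p, ∑ j, l j * p j - c ≤ H i p)
    {v : ℕ → Fin N → ℝ} {ρ : ℕ → ℝ} (hρ : ∀ n, 0 < ρ n) (hρ0 : Tendsto ρ atTop (𝓝 0))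
    (hv : ∀ n, IsDiscountedSolution H (ρ n) (v n)) :
    ∃ (φ : ℕ → ℕ) (γ : ℝ) (ξ : Fin N → ℝ), StrictMono φ ∧
      (∀ i, Tendsto (fun n => ρ (φ n) * v (φ n) i) atTop (𝓝 γ)) ∧
      ∀ i, Tendsto (fun n => v (φ n) i - v (φ n) 0) atTop (𝓝 (ξ i)) := by
  obtain ⟨B, hB⟩ := exists_abs_sub_le_of_isDiscountedSolution hV hmono hcoer
  set K := ∑ k, |H k 0|
  set x : ℕ → ℝ × (Fin N → ℝ) := fun n => (ρ n * v n 0, fun i => v n i - v n 0)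
  have hx : ∀ n, x n ∈ Set.Icc (-K) K ×ˢ Set.pi Set.univ fun _ : Fin N => Set.Icc (-B) B :=
    fun n => ⟨abs_le.1 ((hv n).abs_mul_le hmono (hρ n) 0),
      fun i _ => abs_le.1 (hB _ (hρ n) _ (hv n) i 0)⟩
  obtain ⟨⟨γ, ξ⟩, -, φ, hφ, hlim⟩ :=
    (isCompact_Icc.prod (isCompact_univ_pi fun _ => isCompact_Icc)).tendsto_subseq hx
  have h1 : Tendsto (fun n => ρ (φ n) * v (φ n) 0) atTop (𝓝 γ) :=
    (continuous_fst.tendsto _).comp hlim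
  have h2 : ∀ i, Tendsto (fun n => v (φ n) i - v (φ n) 0) atTop (𝓝 (ξ i)) := fun i =>
    (((continuous_apply i).comp continuous_snd).tendsto _).comp hlim
  refine ⟨φ, γ, ξ, hφ, fun i => ?_, h2⟩
  -- `ρ v_i = ρ v_0 + ρ (v_i - v_0)`, where the last term vanishes; hence `γ` does not depend on
  -- `i`.
  have h3 := h1.add ((hρ0.comp hφ.tendsto_atTop).mul (h2 i))
  rw [zero_mul, add_zero] at h3
  refine h3.congr fun n => ?_
  simp only [Function.comp_apply]
  ring

/-- The vanishing discount limit. -/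
theorem vanishing_discount [NeZero N] (hV : IsConnectedDigraph V)
    (hmono : ∀ i, Monotone (H i)) (hcont : ∀ i, Continuous (H i))
    (hcoer : ∀ i, ∃ (l : V i → ℝ) (c : ℝ), (∀ j, 0 < l j) ∧ ∀ p, ∑ j, l j * p j - c ≤ H i p)
    {u : ℝ → Fin N → ℝ} (hu : ∀ r, 0 < r → IsDiscountedSolution H r (u r)) :
    ∃ γ : ℝ,
      (∀ i, Tendsto (fun r => r * u r i) (𝓝[>] 0) (𝓝 γ)) ∧
      (∃ ρ : ℕ → ℝ, (∀ n, 0 < ρ n) ∧ Tendsto ρ atTop (𝓝 0) ∧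
        ∀ i, ∃ ξ : ℝ, Tendsto (fun n => u (ρ n) i - u (ρ n) 0) atTop (𝓝 ξ)) ∧
      (∀ ρ : ℕ → ℝ, (∀ n, 0 < ρ n) → Tendsto ρ atTop (𝓝 0) →
        ∀ ξ : Fin N → ℝ,
          (∀ i, Tendsto (fun n => u (ρ n) i - u (ρ n) 0) atTop (𝓝 (ξ i))) →
          ∀ i, H i (fun j => ξ j - ξ i) = γ) := by
  have hσ : ∀ n : ℕ, 0 < 1 / ((n : ℝ) + 1) := fun n => by positivity
  obtain ⟨φ, γ, ξ, hφ, hγ, hξ⟩ := exists_subseq_tendsto hV hmono hcoer hσ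
    tendsto_one_div_add_atTop_nhds_zero_nat fun n => hu _ (hσ n)
  have hH : ∀ i, H i (fun j => ξ j - ξ i) = γ := fun i =>
    hamiltonian_eq_of_tendsto hcont (fun n => hu _ (hσ (φ n))) (hγ i) hξ
  have hlim : ∀ i, Tendsto (fun r => r * u r i) (𝓝[>] 0) (𝓝 γ) := fun i => by
    refine tendsto_of_subseq_tendsto fun ρ hρ => ?_
    obtain ⟨hρ0, hρpos⟩ := tendsto_nhdsWithin_iff.1 hρ
    -- Positivity holds only eventually along `ρ`; the shift by `n₀` makes it hold for all indices.
    obtain ⟨n₀, hn₀⟩ := eventually_atTop.1 hρpos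
    have hpos : ∀ n, 0 < ρ (n + n₀) := fun n => hn₀ _ (Nat.le_add_left _ _)
    obtain ⟨ψ, γ', ξ', hψ, hγ', hξ'⟩ := exists_subseq_tendsto hV hmono hcoer hpos
      ((tendsto_add_atTop_iff_nat n₀).2 hρ0) fun n => hu _ (hpos n)
    have hH' : ∀ i, H i (fun j => ξ' j - ξ' i) = γ' := fun i =>
      hamiltonian_eq_of_tendsto hcont (fun n => hu _ (hpos (ψ n))) (hγ' i) hξ'
    obtain rfl : γ = γ' :=
      le_antisymm (ergodic_constant_le hmono hH hH') (ergodic_constant_le hmono hH' hH)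
    exact ⟨fun n => ψ n + n₀, hγ' i⟩
  refine ⟨γ, hlim, ⟨fun n => 1 / ((φ n : ℝ) + 1), fun n => hσ _,
    tendsto_one_div_add_atTop_nhds_zero_nat.comp hφ.tendsto_atTop, fun i => ⟨ξ i, hξ i⟩⟩,
    fun ρ hρ hρ0 ξ' hξ' i => ?_⟩
  exact hamiltonian_eq_of_tendsto hcont (fun n => hu _ (hρ n))
    ((hlim i).comp (tendsto_nhdsWithin_iff.2 ⟨hρ0, Eventually.of_forall hρ⟩)) hξ'

end StationaryEquation

/-! ### Extended integrals, joint measurability and discounted integration by parts -/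

section ExtendedIntegral

variable {α : Type*} [MeasurableSpace α] {μ : Measure α}

/-- Monotonicity of `∫⁻` needs no measurability, so path costs can be compared with integrable
functions directly. -/
lemma extendedIntegral_mono_ae {f g : α → EReal} (h : f ≤ᵐ[μ] g) :
    extendedIntegral μ f ≤ extendedIntegral μ g := by
  refine EReal.sub_le_sub ?_ ?_ <;> refine EReal.coe_ennreal_le_coe_ennreal_iff.2 ?_ <;>
    refine lintegral_mono_ae ?_ <;> filter_upwards [h] with x hx
  · exact EReal.toENNReal_le_toENNReal hx
  · exact EReal.toENNReal_le_toENNReal (EReal.neg_le_neg_iff.2 hx)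

lemma extendedIntegral_coe {f : α → ℝ} (hf : Integrable f μ) :
    extendedIntegral μ (fun x => (f x : EReal)) = ((∫ x, f x ∂μ : ℝ) : EReal) := by
  have h1 : ∫⁻ x, ENNReal.ofReal (f x) ∂μ ≠ ⊤ :=
    (lt_of_le_of_lt (lintegral_mono fun x => Real.ofReal_le_enorm (f x)) hf.2).ne
  have h2 : ∫⁻ x, ENNReal.ofReal (-f x) ∂μ ≠ ⊤ :=
    (lt_of_le_of_lt (lintegral_mono fun x => Real.ofReal_le_enorm (-f x)) hf.neg.2).ne
  have hpos : ∀ x : ℝ, (x : EReal).toENNReal = ENNReal.ofReal x := fun x => by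
    rw [EReal.toENNReal_of_ne_top (EReal.coe_ne_top x), EReal.toReal_coe]
  rw [integral_eq_lintegral_pos_part_sub_lintegral_neg_part hf, EReal.coe_sub,
    EReal.coe_ennreal_toReal h1, EReal.coe_ennreal_toReal h2]
  simp only [extendedIntegral, ← EReal.coe_neg, hpos]

end ExtendedIntegral

/-- The process is the pointwise limit of its values at grid times approaching `t` from the right.
Each grid is countable, so the approximations are jointly measurable. -/
lemma measurable_uncurry_of_eventually_eq_right {Ω E : Type*} [MeasurableSpace Ω]
    [TopologicalSpace E] [TopologicalSpace.PseudoMetrizableSpace E] [MeasurableSpace E]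
    [BorelSpace E] {X : ℝ≥0 → Ω → E} (hX : ∀ t, Measurable (X t))
    (hright : ∀ ω t, ∀ᶠ s in 𝓝[>] t, X s ω = X t ω) :
    Measurable fun p : ℝ≥0 × Ω => X p.1 p.2 := by
  -- Adding 1 to the floor gives `d n t > t` even at grid points, as `𝓝[>] t` requires.
  set d : ℕ → ℝ≥0 → ℝ≥0 := fun n t => ((⌊((n : ℝ≥0) + 1) * t⌋₊ : ℝ≥0) + 1) / (n + 1) with hd
  have hgt : ∀ n t, t < d n t := fun n t => by
    rw [hd, lt_div_iff₀ (by positivity), mul_comm]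
    exact Nat.lt_floor_add_one _
  have hle : ∀ n t, d n t ≤ t + 1 / (n + 1) := fun n t => by
    have h0 : (n : ℝ≥0) + 1 ≠ 0 := by positivity
    have h1 : (t + 1 / ((n : ℝ≥0) + 1)) * (n + 1) = (n + 1) * t + 1 := by
      field_simp
    rw [hd, div_le_iff₀ (by positivity), h1]
    gcongr
    exact Nat.floor_le (by positivity)
  have hlim : ∀ t, Tendsto (fun n => d n t) atTop (𝓝[>] t) := fun t => by
    refine tendsto_nhdsWithin_iff.2 ⟨?_, Eventually.of_forall fun n => hgt n t⟩
    refine tendsto_of_tendsto_of_tendsto_of_le_of_le tendsto_const_nhds ?_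
      (fun n => (hgt n t).le) (fun n => hle n t)
    have : Tendsto (fun n : ℕ => 1 / ((n : ℝ≥0) + 1)) atTop (𝓝 0) :=
      tendsto_one_div_add_atTop_nhds_zero_nat
    simpa using this.const_add t
  refine measurable_of_tendsto_metrizable (f := fun n (p : ℝ≥0 × Ω) => X (d n p.1) p.2)
    (fun n => ?_) (tendsto_pi_nhds.2 fun p => ?_)
  · have h1 : Measurable fun q : ℕ × Ω => X (((q.1 : ℝ≥0) + 1) / (n + 1)) q.2 :=
      measurable_from_prod_countable_right fun k => hX (((k : ℝ≥0) + 1) / (n + 1))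
    have h2 : Measurable fun p : ℝ≥0 × Ω => (⌊((n : ℝ≥0) + 1) * p.1⌋₊, p.2) :=
      (Nat.measurable_floor.comp (measurable_fst.const_mul _)).prodMk measurable_snd
    simpa only [hd, Function.comp_def] using h1.comp h2
  · exact tendsto_const_nhds.congr'
      (((hlim p.1).eventually (hright p.2 p.1)).mono fun _ hn => hn.symm)

/-- Since `m` is merely integrable, its primitive is only absolutely continuous; the product rule is
applied almost everywhere. -/
lemma integral_exp_mul_sub {m : ℝ → ℝ} {T : ℝ} (hm : IntervalIntegrable m volume 0 T) (r c : ℝ) :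
    ∫ t in (0 : ℝ)..T, Real.exp (-(r * t)) * (m t - r * (c + ∫ s in (0 : ℝ)..t, m s))
      = Real.exp (-(r * T)) * (c + ∫ s in (0 : ℝ)..T, m s) - c := by
  set Y : ℝ → ℝ := fun t => c + ∫ s in (0 : ℝ)..t, m s with hY
  set e : ℝ → ℝ := fun t => Real.exp (-(r * t)) with he
  have hYac : AbsolutelyContinuousOnInterval Y 0 T :=
    AbsolutelyContinuousOnInterval.add
      (contDiff_const.contDiffOn.absolutelyContinuousOnInterval)
      (hm.absolutelyContinuousOnInterval_intervalIntegral Set.left_mem_uIcc)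
  have heac : AbsolutelyContinuousOnInterval e 0 T :=
    (ContDiff.contDiffOn (by fun_prop)).absolutelyContinuousOnInterval
  have hde : ∀ t, HasDerivAt e (-r * e t) t := fun t => by
    have h1 : HasDerivAt (fun t : ℝ => -(r * t)) (-(r * 1)) t := ((hasDerivAt_id t).const_mul r).neg
    have := h1.exp
    simpa [he, mul_comm] using this
  have key := AbsolutelyContinuousOnInterval.integral_deriv_mul_eq_sub heac hYac
  have h0 : e 0 * Y 0 = c := by simp [he, hY]
  rw [h0] at key
  rw [← key]
  refine intervalIntegral.integral_congr_ae ?_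
  filter_upwards [hm.ae_hasDerivAt_integral] with t ht htT
  have hd : HasDerivAt Y (m t) t :=
    (ht (Set.uIoc_subset_uIcc htT) 0 Set.left_mem_uIcc).const_add c
  rw [hd.deriv, (hde t).deriv]
  simp only [hY]
  ring

/-! ### Dynkin's formula for the controlled chain -/

section Chain

variable {Ω : Type*} {m : MeasurableSpace Ω} {P : Measure Ω} {ℱ : Filtration ℝ≥0 m} {N : ℕ}
  {V : Fin N → Finset (Fin N)} {a : Control V} {i : Fin N} {X : ℝ≥0 → Ω → Fin N}

lemma IsControlledChain.measurable_uncurry (hX : IsControlledChain P ℱ a i X) :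
    Measurable fun p : ℝ × Ω => X p.1.toNNReal p.2 :=
  (measurable_uncurry_of_eventually_eq_right (fun t => (hX.adapted t).mono (ℱ.le t) le_rfl)
    hX.right_continuous).comp
    ((measurable_real_toNNReal.comp measurable_fst).prodMk measurable_snd)

lemma IsControlledChain.integrable_prod [IsFiniteMeasure P] (hX : IsControlledChain P ℱ a i X)
    {μ : Measure ℝ} [SFinite μ] {g : ℝ → Fin N → ℝ} (hg : ∀ k, Integrable (fun t => g t k) μ) :
    Integrable (fun p : ℝ × Ω => g p.1 (X p.1.toNNReal p.2)) (μ.prod P) := by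
  have h : (fun p : ℝ × Ω => g p.1 (X p.1.toNNReal p.2)) = fun p => ∑ k,
      ((fun p : ℝ × Ω => X p.1.toNNReal p.2) ⁻¹' {k}).indicator (fun p => g p.1 k) p := by
    ext p
    rw [Finset.sum_eq_single (X p.1.toNNReal p.2)]
    · simp
    · intro k _ hk
      exact Set.indicator_of_notMem (by simpa using Ne.symm hk) _
    · simp
  rw [h]
  exact integrable_finsetSum _ fun k _ => ((hg k).comp_fst P).indicator
    (hX.measurable_uncurry (measurableSet_singleton k))

lemma IsAdmissible.integrableOn_generator (ha : IsAdmissible a) (f : Fin N → ℝ) (k : Fin N)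
    (T : ℝ) : IntegrableOn (fun t : ℝ => generator a t.toNNReal f k) (Set.Icc 0 T) :=
  integrable_finsetSum _ fun j _ => (ha T k j).mul_const _

lemma integrable_comp_of_finite [IsFiniteMeasure P] {x : Ω → Fin N} (hx : Measurable x)
    (f : Fin N → ℝ) : Integrable (fun ω => f (x ω)) P :=
  Integrable.of_bound ((measurable_of_finite f).comp hx).aestronglyMeasurable (∑ k, |f k|)
    (Eventually.of_forall fun ω => Finset.single_le_sum (f := fun k => |f k|)
      (fun _ _ => abs_nonneg _) (Finset.mem_univ (x ω)))

lemma IsControlledChain.measurable (hX : IsControlledChain P ℱ a i X) (t : ℝ≥0) :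
    Measurable (X t) := (hX.adapted t).mono (ℱ.le t) le_rfl

/-- Dynkin's formula. -/
lemma IsControlledChain.integral_comp_eq [IsProbabilityMeasure P]
    (hX : IsControlledChain P ℱ a i X) (ha : IsAdmissible a) (f : Fin N → ℝ) {t : ℝ}
    (ht : 0 ≤ t) :
    ∫ ω, f (X t.toNNReal ω) ∂P = f i
      + ∫ s in (0 : ℝ)..t, ∫ ω, generator a s.toNNReal f (X s.toNNReal ω) ∂P := by
  set G : ℝ → Ω → ℝ := fun s ω => generator a s.toNNReal f (X s.toNNReal ω) with hG
  have hint : Integrable (fun p : ℝ × Ω => G p.1 p.2)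
      ((volume.restrict (Set.Ioc 0 t)).prod P) :=
    hX.integrable_prod (g := fun s k => generator a s.toNNReal f k) fun k =>
      (ha.integrableOn_generator f k t).mono_set Set.Ioc_subset_Icc_self
  have hswap : ∫ s in (0 : ℝ)..t, ∫ ω, G s ω ∂P = ∫ ω, (∫ s in (0 : ℝ)..t, G s ω) ∂P := by
    simp only [intervalIntegral.integral_of_le ht]
    exact integral_integral_swap (f := G) hint
  have hint2 : Integrable (fun ω => ∫ s in (0 : ℝ)..t, G s ω) P := by
    simp only [intervalIntegral.integral_of_le ht]
    exact hint.integral_prod_right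
  -- The expectation of the martingale at `t` equals that at 0, which is zero.
  have hmart := (hX.martingale f).setIntegral_eq (zero_le (a := t.toNNReal)) MeasurableSet.univ
  simp only [setIntegral_univ, Real.coe_toNNReal t ht, NNReal.coe_zero,
    intervalIntegral.integral_same, sub_self, integral_zero] at hmart
  have h0 : ∫ ω, f (X 0 ω) ∂P = f i := by
    rw [integral_congr_ae (g := fun _ => f i) (hX.start.mono fun ω hω => by simp only [hω])]
    simp
  have hf := fun s => integrable_comp_of_finite (P := P) (hX.measurable s) f
  rw [integral_sub (f := fun ω => f (X t.toNNReal ω) - f (X 0 ω)) ((hf _).sub (hf _)) hint2,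
    integral_sub (hf _) (hf _), h0] at hmart
  rw [hswap]
  linarith

lemma IsControlledChain.integral_discounted_generator [IsProbabilityMeasure P]
    (hX : IsControlledChain P ℱ a i X) (ha : IsAdmissible a) (v : Fin N → ℝ) (r : ℝ) {T : ℝ}
    (hT : 0 ≤ T) :
    ∫ t in (0 : ℝ)..T, ∫ ω, Real.exp (-(r * t)) *
        (generator a t.toNNReal v (X t.toNNReal ω) - r * v (X t.toNNReal ω)) ∂P
      = Real.exp (-(r * T)) * (∫ ω, v (X T.toNNReal ω) ∂P) - v i := by
  have hint : Integrable
      (fun p : ℝ × Ω => generator a p.1.toNNReal v (X p.1.toNNReal p.2))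
      ((volume.restrict (Set.Ioc 0 T)).prod P) :=
    hX.integrable_prod (g := fun s k => generator a s.toNNReal v k) fun k =>
      (ha.integrableOn_generator v k T).mono_set Set.Ioc_subset_Icc_self
  have hm : IntervalIntegrable
      (fun t : ℝ => ∫ ω, generator a t.toNNReal v (X t.toNNReal ω) ∂P) volume 0 T := by
    rw [intervalIntegrable_iff_integrableOn_Ioc_of_le hT]
    exact hint.integral_prod_left
  rw [hX.integral_comp_eq ha v hT, ← integral_exp_mul_sub hm]
  refine intervalIntegral.integral_congr_ae ?_
  have hae := (ae_restrict_iff' measurableSet_Ioc).1 hint.prod_right_ae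
  filter_upwards [hae] with t ht htT
  rw [Set.uIoc_of_le hT] at htT
  rw [integral_const_mul, integral_sub (ht htT)
    ((integrable_comp_of_finite (hX.measurable _) v).const_mul r), integral_const_mul,
    hX.integral_comp_eq ha v htT.1.le]

/-- The discounted running payoff that equals `generator a t v k - r * v k` up to time `T` and
the constant `D` afterwards. -/
noncomputable def stoppedRate (a : Control V) (v : Fin N → ℝ) (r T D t : ℝ) (k : Fin N) : ℝ :=
  Real.exp (-(r * t)) * if t ≤ T then generator a t.toNNReal v k - r * v k else D

lemma integrableOn_exp_neg_mul {r : ℝ} (hr : 0 < r) (T : ℝ) :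
    IntegrableOn (fun t : ℝ => Real.exp (-(r * t))) (Set.Ioi T) := by
  simpa using exp_neg_integrableOn_Ioi T hr

lemma IsAdmissible.integrableOn_stoppedRate (ha : IsAdmissible a) (v : Fin N → ℝ) {r : ℝ}
    (hr : 0 < r) {T : ℝ} (hT : 0 ≤ T) (D : ℝ) (k : Fin N) :
    IntegrableOn (fun t => stoppedRate a v r T D t k) (Set.Ioi 0) := by
  rw [← Set.Ioc_union_Ioi_eq_Ioi hT]
  refine IntegrableOn.union ?_ ?_
  · have h1 : IntegrableOn (fun t : ℝ => Real.exp (-(r * t)) *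
        (generator a t.toNNReal v k - r * v k)) (Set.Icc 0 T) :=
      IntegrableOn.continuousOn_mul (by fun_prop)
        ((ha.integrableOn_generator v k T).sub (integrableOn_const (by simp))) isCompact_Icc
    refine (h1.mono_set Set.Ioc_subset_Icc_self).congr_fun (fun t ht => ?_) measurableSet_Ioc
    simp [stoppedRate, ht.2]
  · refine IntegrableOn.congr_fun ((integrableOn_exp_neg_mul hr T).mul_const D) (fun t ht => ?_)
      measurableSet_Ioi
    simp [stoppedRate, not_le.2 (Set.mem_Ioi.1 ht)]

lemma IsControlledChain.integrable_stoppedRate [IsProbabilityMeasure P]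
    (hX : IsControlledChain P ℱ a i X) (ha : IsAdmissible a) (v : Fin N → ℝ) {r : ℝ}
    (hr : 0 < r) {T : ℝ} (hT : 0 ≤ T) (D : ℝ) :
    Integrable (fun p : ℝ × Ω => stoppedRate a v r T D p.1 (X p.1.toNNReal p.2))
      ((volume.restrict (Set.Ici 0)).prod P) := by
  refine hX.integrable_prod fun k => ?_
  rw [Measure.restrict_congr_set Ioi_ae_eq_Ici.symm]
  exact ha.integrableOn_stoppedRate v hr hT D k

lemma IsControlledChain.integral_stoppedRate [IsProbabilityMeasure P]
    (hX : IsControlledChain P ℱ a i X) (ha : IsAdmissible a) (v : Fin N → ℝ) {r : ℝ}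
    (hr : 0 < r) {T : ℝ} (hT : 0 ≤ T) (D : ℝ) :
    ∫ ω, (∫ t in Set.Ici (0 : ℝ), stoppedRate a v r T D t (X t.toNNReal ω)) ∂P
      = Real.exp (-(r * T)) * (∫ ω, v (X T.toNNReal ω) ∂P + D / r) - v i := by
  have hint := hX.integrable_stoppedRate ha v hr hT D
  have hswap := (integral_integral_swap
    (f := fun t ω => stoppedRate a v r T D t (X t.toNNReal ω)) hint).symm
  have hint1 := hint.integral_prod_left
  rw [Measure.restrict_congr_set Ioi_ae_eq_Ici.symm] at hswap hint1 ⊢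
  rw [hswap]
  have hI : IntegrableOn (fun t : ℝ => ∫ ω, stoppedRate a v r T D t (X t.toNNReal ω) ∂P)
    (Set.Ioi 0) := hint1
  rw [← Set.Ioc_union_Ioi_eq_Ioi hT] at hI ⊢
  rw [setIntegral_union Set.Ioc_disjoint_Ioi_same measurableSet_Ioi
    (hI.mono_set Set.subset_union_left) (hI.mono_set Set.subset_union_right)]
  have h1 : ∫ t in Set.Ioc 0 T, ∫ ω, stoppedRate a v r T D t (X t.toNNReal ω) ∂P
      = Real.exp (-(r * T)) * (∫ ω, v (X T.toNNReal ω) ∂P) - v i := by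
    rw [← hX.integral_discounted_generator ha v r hT, intervalIntegral.integral_of_le hT]
    refine setIntegral_congr_fun measurableSet_Ioc fun t ht => ?_
    simp [stoppedRate, ht.2]
  have h2 : ∫ t in Set.Ioi T, ∫ ω, stoppedRate a v r T D t (X t.toNNReal ω) ∂P
      = Real.exp (-(r * T)) * (D / r) := by
    rw [setIntegral_congr_fun (g := fun t => Real.exp (-r * t) * D) measurableSet_Ioi
      fun t ht => by simp [stoppedRate, not_le.2 (Set.mem_Ioi.1 ht)]]
    rw [integral_mul_const, integral_exp_mul_Ioi (neg_neg_of_pos hr), neg_mul]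
    field_simp
  rw [h1, h2]
  ring

end Chain

/-! ### Verification: the value function solves the stationary equation -/

section Verification

variable {Ω : Type*} {m : MeasurableSpace Ω} {P : Measure Ω} [IsProbabilityMeasure P]
  {ℱ : Filtration ℝ≥0 m} {N : ℕ} {V : Fin N → Finset (Fin N)} {a : Control V} {i : Fin N}
  {X : ℝ≥0 → Ω → Fin N} {L : (i : Fin N) → (V i → ℝ≥0) → EReal} {v : Fin N → ℝ} {r : ℝ}

lemma abs_integral_comp_le {x : Ω → Fin N} (f : Fin N → ℝ) :
    |∫ ω, f (x ω) ∂P| ≤ ∑ k, |f k| := by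
  simpa using norm_integral_le_of_norm_le_const (μ := P) (f := fun ω => f (x ω))
    (C := ∑ k, |f k|) (Eventually.of_forall fun ω =>
      Finset.single_le_sum (f := fun k => |f k|) (fun _ _ => abs_nonneg _)
        (Finset.mem_univ (x ω)))

/-- Admissible rates are only locally integrable, so Dynkin's formula is used up to `T`, with a
constant rate afterwards. The terminal and tail terms carry the factor `e^{-rT}`. -/
lemma IsControlledChain.tendsto_integral_stoppedRate (hX : IsControlledChain P ℱ a i X)
    (ha : IsAdmissible a) (v : Fin N → ℝ) (hr : 0 < r) (D : ℝ) :
    Tendsto (fun T : ℝ => -∫ ω, (∫ t in Set.Ici (0 : ℝ), stoppedRate a v r T D t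
      (X t.toNNReal ω)) ∂P) atTop (𝓝 (v i)) := by
  have h0 : Tendsto (fun T : ℝ => Real.exp (-(r * T))) atTop (𝓝 0) :=
    Real.tendsto_exp_neg_atTop_nhds_zero.comp (tendsto_id.const_mul_atTop hr)
  have h1 : Tendsto (fun T : ℝ => Real.exp (-(r * T)) *
      (∫ ω, v (X T.toNNReal ω) ∂P + D / r)) atTop (𝓝 0) := by
    refine h0.zero_mul_isBoundedUnder_le ⟨∑ k, |v k| + |D / r|, ?_⟩
    refine eventually_map.2 (Eventually.of_forall fun T => ?_)
    exact (abs_add_le _ _).trans (by gcongr; exact abs_integral_comp_le v)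
  have h2 := (h1.sub_const (v i)).neg
  rw [zero_sub, neg_neg] at h2
  refine h2.congr' ?_
  filter_upwards [eventually_ge_atTop 0] with T hT
  rw [hX.integral_stoppedRate ha v hr hT D]

lemma extendedIntegral_neg_pathCost_le_of_le (hX : IsControlledChain P ℱ a i X)
    (ha : IsAdmissible a) (hr : 0 < r) {T D : ℝ} (hT : 0 ≤ T)
    (h : ∀ t, 0 ≤ t → ∀ k,
      (stoppedRate a v r T D t k : EReal)
        ≤ ((Real.exp (-(r * t)) : ℝ) : EReal) * L k (a t.toNNReal k)) :
    extendedIntegral P (fun ω => -pathCost L r a fun t => X t ω)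
      ≤ ((-∫ ω, (∫ t in Set.Ici (0 : ℝ), stoppedRate a v r T D t (X t.toNNReal ω)) ∂P : ℝ) :
        EReal) := by
  have hint := hX.integrable_stoppedRate ha v hr hT D
  have hI : Integrable (fun ω => -∫ t in Set.Ici (0 : ℝ), stoppedRate a v r T D t
      (X t.toNNReal ω)) P := hint.integral_prod_right.neg
  rw [← integral_neg, ← extendedIntegral_coe hI]
  refine extendedIntegral_mono_ae ?_
  filter_upwards [hint.prod_left_ae] with ω hω
  rw [EReal.coe_neg, EReal.neg_le_neg_iff, ← extendedIntegral_coe hω]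
  refine extendedIntegral_mono_ae ?_
  filter_upwards [ae_restrict_mem measurableSet_Ici] with t ht
  exact h t ht _

lemma le_extendedIntegral_neg_pathCost_of_le (hX : IsControlledChain P ℱ a i X)
    (ha : IsAdmissible a) (hr : 0 < r) {T D : ℝ} (hT : 0 ≤ T)
    (h : ∀ t, 0 ≤ t → ∀ k, ((Real.exp (-(r * t)) : ℝ) : EReal) * L k (a t.toNNReal k)
      ≤ (stoppedRate a v r T D t k : EReal)) :
    ((-∫ ω, (∫ t in Set.Ici (0 : ℝ), stoppedRate a v r T D t (X t.toNNReal ω)) ∂P : ℝ) : EReal)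
      ≤ extendedIntegral P (fun ω => -pathCost L r a fun t => X t ω) := by
  have hint := hX.integrable_stoppedRate ha v hr hT D
  have hI : Integrable (fun ω => -∫ t in Set.Ici (0 : ℝ), stoppedRate a v r T D t
      (X t.toNNReal ω)) P := hint.integral_prod_right.neg
  rw [← integral_neg, ← extendedIntegral_coe hI]
  refine extendedIntegral_mono_ae ?_
  filter_upwards [hint.prod_left_ae] with ω hω
  rw [EReal.coe_neg, EReal.neg_le_neg_iff, ← extendedIntegral_coe hω]
  refine extendedIntegral_mono_ae ?_
  filter_upwards [ae_restrict_mem measurableSet_Ici] with t ht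
  exact h t ht _

/-- A supersolution of the Hamilton-Jacobi equation dominates the payoff of every control. -/
lemma extendedIntegral_neg_pathCost_le (hX : IsControlledChain P ℱ a i X)
    (ha : IsAdmissible a) (hr : 0 < r) {C : ℝ} (hC : ∀ i l, (C : EReal) ≤ L i l)
    (hv : ∀ k l, ((∑ j : V k, (l j : ℝ) * (v j - v k) - r * v k : ℝ) : EReal) ≤ L k l) :
    extendedIntegral P (fun ω => -pathCost L r a fun t => X t ω) ≤ (v i : EReal) := by
  -- The tail rate is the lower bound `C` of the cost, so the stopped rate stays below the true cost
  -- after `T` too.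
  refine ge_of_tendsto ((continuous_coe_real_ereal.tendsto _).comp
    (hX.tendsto_integral_stoppedRate ha v hr C)) ?_
  filter_upwards [eventually_ge_atTop 0] with T hT
  refine extendedIntegral_neg_pathCost_le_of_le hX ha hr hT fun t _ k => ?_
  rw [stoppedRate, EReal.coe_mul]
  refine mul_le_mul_of_nonneg_left ?_ (EReal.coe_nonneg.2 (Real.exp_pos _).le)
  split_ifs
  exacts [hv k _, hC k _]

/-- A constant control for which `v` is a subsolution has a payoff of at least `v`. -/
lemma le_extendedIntegral_neg_pathCost {l : (i : Fin N) → V i → ℝ≥0} {c : Fin N → ℝ}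
    (hX : IsControlledChain P ℱ (fun _ => l) i X) (ha : IsAdmissible fun _ : ℝ≥0 => l)
    (hr : 0 < r) (hc : ∀ k, L k (l k) = c k)
    (hv : ∀ k, c k ≤ ∑ j : V k, (l k j : ℝ) * (v j - v k) - r * v k) :
    (v i : EReal) ≤ extendedIntegral P (fun ω => -pathCost L r (fun _ => l) fun t => X t ω) := by
  -- Here the tail rate must dominate the cost, which takes only the values `c k`.
  refine le_of_tendsto ((continuous_coe_real_ereal.tendsto _).comp
    (hX.tendsto_integral_stoppedRate ha v hr (∑ k, |c k|))) ?_
  filter_upwards [eventually_ge_atTop 0] with T hT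
  refine le_extendedIntegral_neg_pathCost_of_le hX ha hr hT fun t _ k => ?_
  rw [stoppedRate, hc, ← EReal.coe_mul, EReal.coe_le_coe_iff]
  refine mul_le_mul_of_nonneg_left ?_ (Real.exp_pos _).le
  split_ifs
  · exact hv k
  · exact (le_abs_self _).trans (Finset.single_le_sum (f := fun k => |c k|)
      (fun _ _ => abs_nonneg _) (Finset.mem_univ k))

lemma isAdmissible_const (l : (i : Fin N) → V i → ℝ≥0) : IsAdmissible fun _ : ℝ≥0 => l :=
  fun _ _ _ => integrableOn_const (by simp)

lemma value_eq_of_isDiscountedSolution {X : Fin N → Control V → ℝ≥0 → Ω → Fin N}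
    (hX : ∀ i a, IsAdmissible a → IsControlledChain P ℱ a i (X i a))
    (h0 : ∀ i, ∃ l, L i l < ⊤) {C : ℝ} (hC : ∀ i l, (C : EReal) ≤ L i l)
    (hL : ∀ i, Tendsto (fun l => L i l / (supNorm l : EReal)) (comap supNorm atTop) (𝓝 ⊤))
    (hr : 0 < r) (hv : IsDiscountedSolution (realHamiltonian L) r v) (i : Fin N) :
    value P L X r i = (v i : EReal) := by
  refine le_antisymm (iSup₂_le fun a ha => ?_) ?_
  · refine extendedIntegral_neg_pathCost_le (hX i a ha) ha hr hC fun k l => ?_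
    induction hl : L k l using EReal.rec with
    | bot => exact absurd (hl ▸ hC k l) (not_le.2 (EReal.bot_lt_coe _))
    | coe c =>
      have := sum_sub_le_realHamiltonian (h0 k) (hC k) (hL k) (fun j => v j - v k) hl
      rw [← hv k] at this
      exact EReal.coe_le_coe_iff.2 (by linarith)
    | top => exact le_top
  -- At each node a rate vector that is `ε`-optimal in the Hamiltonian is frozen in time. Lowering
  -- `v` by `ε / r` keeps its differences and lowers `r v` by exactly `ε`, which absorbs the error.
  · have key : ∀ ε : ℝ, 0 < ε → ((v i - ε / r : ℝ) : EReal) ≤ value P L X r i := fun ε hε => by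
      have hex : ∀ k, ∃ (l : V k → ℝ≥0) (c : ℝ), L k l = c ∧
          r * v k - ε < ∑ j : V k, (l j : ℝ) * (v j - v k) - c := fun k => by
        have h1 : ¬ realHamiltonian L k (fun j => v j - v k) ≤ r * v k - ε := by
          rw [← hv k]
          linarith
        rw [realHamiltonian_le_iff (h0 k) (hC k) (hL k)] at h1
        push Not at h1
        exact h1
      choose l c hc hlt using hex
      have ha := isAdmissible_const l
      refine le_trans ?_ (le_iSup₂ (fun _ : ℝ≥0 => l) ha)
      refine le_extendedIntegral_neg_pathCost (v := fun k => v k - ε / r) (hX i _ ha) ha hr hc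
        fun k => ?_
      have h2 : r * (v k - ε / r) = r * v k - ε := by field_simp
      simp only [sub_sub_sub_cancel_right, h2]
      linarith [hlt k]
    have hlim : Tendsto (fun ε : ℝ => ((v i - ε / r : ℝ) : EReal)) (𝓝[>] 0) (𝓝 (v i)) := by
      have : Continuous fun ε : ℝ => ((v i - ε / r : ℝ) : EReal) :=
        continuous_coe_real_ereal.comp (by fun_prop)
      simpa using (this.tendsto 0).mono_left nhdsWithin_le_nhds
    exact le_of_tendsto hlim (eventually_mem_nhdsWithin.mono fun ε hε => key ε hε)

end Verification

end GraphControl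

/-! ### The main theorem -/

theorem mainTheorem2 {Ω : Type*} {m : MeasurableSpace Ω} (P : Measure Ω) [IsProbabilityMeasure P]
    (ℱ : Filtration ℝ≥0 m) {N : ℕ} [NeZero N]
    (V : Fin N → Finset (Fin N)) (hV : GraphControl.IsConnectedDigraph V)
    (L : (i : Fin N) → (V i → ℝ≥0) → EReal)
    (hL_nondegenerate : ∀ i, ∃ l : V i → ℝ≥0, (∀ j, 0 < l j) ∧ L i l < ⊤)
    (hL_lsc : ∀ i, LowerSemicontinuous (L i))
    (hL_bounded_below : ∃ C : ℝ, ∀ i l, (C : EReal) ≤ L i l)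
    (hL_superlinear : ∀ i, Tendsto (fun l => L i l / (GraphControl.supNorm l : EReal))
      (comap GraphControl.supNorm atTop) (𝓝 ⊤))
    (X : Fin N → GraphControl.Control V → ℝ≥0 → Ω → Fin N)
    (hX : ∀ i a, GraphControl.IsAdmissible a → GraphControl.IsControlledChain P ℱ a i (X i a)) :
    ∃ u : ℝ → Fin N → ℝ,
      (∀ r : ℝ, 0 < r → ∀ i, GraphControl.value P L X r i = (u r i : EReal)) ∧
      ∃ γ : ℝ,
        (∀ i, Tendsto (fun r => r * u r i) (𝓝[>] 0) (𝓝 γ)) ∧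
        (∃ ρ : ℕ → ℝ, (∀ n, 0 < ρ n) ∧ Tendsto ρ atTop (𝓝 0) ∧
          ∀ i, ∃ ξ : ℝ, Tendsto (fun n => u (ρ n) i - u (ρ n) 0) atTop (𝓝 ξ)) ∧
        (∀ ρ : ℕ → ℝ, (∀ n, 0 < ρ n) → Tendsto ρ atTop (𝓝 0) →
          ∀ ξ : Fin N → ℝ,
            (∀ i, Tendsto (fun n => u (ρ n) i - u (ρ n) 0) atTop (𝓝 (ξ i))) →
            ∀ i, -(γ : EReal) +
              GraphControl.hamiltonian L i (fun j => ξ j - ξ i) = 0) := by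
  open GraphControl in
  obtain ⟨C, hC⟩ := hL_bounded_below
  have h0 : ∀ i, ∃ l, L i l < ⊤ := fun i => (hL_nondegenerate i).imp fun _ => And.right
  have hmono : ∀ i, Monotone (realHamiltonian L i) := fun i =>
    realHamiltonian_monotone (h0 i) (hC i) (hL_superlinear i)
  have hcont : ∀ i, Continuous (realHamiltonian L i) := fun i =>
    realHamiltonian_continuous (h0 i) (hC i) (hL_superlinear i)
  have hcoer : ∀ i, ∃ (l : V i → ℝ) (c : ℝ), (∀ j, 0 < l j) ∧
      ∀ p, ∑ j, l j * p j - c ≤ realHamiltonian L i p := fun i => by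
    obtain ⟨l, hl, htop⟩ := hL_nondegenerate i
    have hbot : L i l ≠ ⊥ := ((EReal.bot_lt_coe C).trans_le (hC i l)).ne'
    exact ⟨fun j => l j, (L i l).toReal, fun j => NNReal.coe_pos.2 (hl j), fun p =>
      sum_sub_le_realHamiltonian (h0 i) (hC i) (hL_superlinear i) p
        (EReal.coe_toReal htop.ne hbot).symm⟩
  -- For `r ≤ 0` the vector 0 is a dummy, so that `u` is defined on all of `ℝ`.
  have hex : ∀ r : ℝ, ∃ v, 0 < r → IsDiscountedSolution (realHamiltonian L) r v := fun r => by
    by_cases hr : 0 < r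
    · exact (exists_isDiscountedSolution hmono hcont hr).imp fun _ hv _ => hv
    · exact ⟨0, fun h => absurd h hr⟩
  choose u hu using hex
  obtain ⟨γ, h1, h2, h3⟩ := vanishing_discount hV hmono hcont hcoer hu
  refine ⟨u, fun r hr i => value_eq_of_isDiscountedSolution hX h0 hC hL_superlinear hr (hu r hr) i,
    γ, h1, h2, fun ρ hρ hρ0 ξ hξ i => ?_⟩
  rw [← coe_realHamiltonian (h0 i) (hC i) (hL_superlinear i), h3 ρ hρ hρ0 ξ hξ i,
    ← EReal.coe_neg, ← EReal.coe_add, neg_add_cancel, EReal.coe_zero]
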